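/- Let $\nu\in(0,1]$, let $k\ge 1$ be an integer, let $\lambda_1,\dots,\lambda_k>0$, and put $\Lambda=\lambda_1+\dots+\lambda_k$. Let $\{M^\nu(t);t\ge 0\}$ be a process with values in $\{0,1,2,\dots\}$ whose probabilities $p_j(t)=\mathbb P\{M^\nu(t)=j\}$, $j\ge 0$, are continuous on $[0,\infty)$ and satisfy $p_0(0)=1$, $p_j(0)=0$ for $j\ge1$, and $$\frac{d^\nu p_j(t)}{dt^\nu}=\sum_{r=1}^{\min(j,k)}\lambda_r\,p_{j-r}(t)-\Lambda\,p_j(t),\qquad t>0,\ j\ge 0 .$$ Here $\frac{d^\nu}{dt^\nu}$ is the Caputo derivative: for $\nu=1$ it is the ordinary derivative, and for $0<\nu<1$ it is $\frac{d^\nu f(t)}{dt^\nu}=\frac1{\Gamma(1-\nu)}\int_0^t\frac{f'(s)}{(t-s)^\nu}\,ds$, where $f$ is absolutely continuous on bounded intervals $[0,t]$ and the integral converges absolutely. Let $N^\nu_\Lambda$ be a fractional Poisson process of order $\nu$ and intensity $\Lambda$, that is, the renewal process (number of renewals in $[0,t]$) whose interarrival times are i.i.d. with density $\Lambda t^{\nu-1}E_{\nu,\nu}(-\Lambda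 t^\nu)$ on $(0,\infty)$, where $E_{\alpha,\beta}(x)=\sum_{r\ge0}\frac{x^r}{\Gamma(\alpha r+\beta)}$. On the same probability space as $N^\nu_\Lambda$, let $X_1,X_2,\dots$ be i.i.d. random variables with $\mathbb P\{X_n=j\}=\lambda_j/\Lambda$ for $j=1,\dots,k$, such that for every $t\ge0$ the sequence $(X_n)_{n\ge1}$ is independent of $N^\nu_\Lambda(t)$. Then, for every $t\ge 0$, $$M^\nu(t)\overset{d}{=}\sum_{i=1}^{N^\nu_\Lambda(t)}X_i .$$ -/

import Mathlib

open MeasureTheory ProbabilityTheory Set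
open scoped NNReal

namespace FracCounting

noncomputable section

/-- The two-parameter Mittag-Leffler function `E_{α,β}(x) = ∑_{r ≥ 0} x ^ r / Γ(α r + β)`
(used for `α, β > 0`, where the series converges for every real `x`). -/
def mittagLeffler (α β x : ℝ) : ℝ :=
  ∑' r : ℕ, x ^ r / Real.Gamma (α * r + β)

/-- The interarrival density `λ t ^ (ν - 1) E_{ν,ν}(-λ t ^ ν)`, `t > 0`, of the fractional
Poisson process of order `ν` and intensity `lam`. -/
def interarrivalDensity (ν lam t : ℝ) : ℝ :=
  lam * t ^ (ν - 1) * mittagLeffler ν ν (-lam * t ^ ν)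

/-- The real random variable `U` takes values in `(0, ∞)` and has density `f` there:
`P(U ∈ B) = ∫_{B ∩ (0, ∞)} f(t) dt` for every Borel set `B`. -/
def HasDensityOnPos {Ω : Type*} [MeasurableSpace Ω] (P : Measure Ω) (U : Ω → ℝ) (f : ℝ → ℝ) :
    Prop :=
  ∀ B : Set ℝ, MeasurableSet B → P.real (U ⁻¹' B) = ∫ t in B ∩ Ioi 0, f t

/-- The renewal counting function of a sequence of interarrival times `u 0, u 1, …`: the number
of renewal epochs `u 0 + ⋯ + u n`, `n ≥ 0`, in `[0, t]`. (For the processes below this is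
almost surely finite.) -/
def renewalCount (u : ℕ → ℝ) (t : ℝ) : ℕ :=
  {n : ℕ | ∑ i ∈ Finset.range (n + 1), u i ≤ t}.ncard

/-- `N` is a fractional Poisson process of order `ν` and intensity `lam`: the renewal process
whose interarrival times are i.i.d. with density `interarrivalDensity ν lam`. -/
def IsFractionalPoissonProcess {Ω : Type*} [MeasurableSpace Ω] (P : Measure Ω) (ν lam : ℝ)
    (N : ℝ≥0 → Ω → ℕ) : Prop :=
  (∀ t, Measurable (N t)) ∧
  ∃ U : ℕ → Ω → ℝ,
    (∀ i, Measurable (U i)) ∧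
    iIndepFun U P ∧
    (∀ i, HasDensityOnPos P (U i) (interarrivalDensity ν lam)) ∧
    ∀ᵐ ω ∂P, ∀ t : ℝ≥0, N t ω = renewalCount (fun i => U i ω) t

/-- `d` is the Caputo derivative of order `ν ∈ (0, 1]` (with base point `0`) of `f` at `t > 0`.
For `ν = 1` this is the ordinary derivative. For `ν < 1` it is
`Γ(1 - ν)⁻¹ ∫_0^t f'(s) (t - s) ^ (-ν) ds`, where `f` is absolutely continuous on `[0, t]` (so
that `f'` exists almost everywhere and `f` is its primitive) and the integral converges. -/
def HasCaputoDerivAt (ν : ℝ) (f : ℝ → ℝ) (d t : ℝ) : Prop :=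
  (ν = 1 ∧ HasDerivAt f d t) ∨
  (ν < 1 ∧ AbsolutelyContinuousOnInterval f 0 t ∧
    IntervalIntegrable (fun s => deriv f s * (t - s) ^ (-ν)) volume 0 t ∧
    d = (Real.Gamma (1 - ν))⁻¹ * ∫ s in (0 : ℝ)..t, deriv f s * (t - s) ^ (-ν))

/-- The total rate `Λ = λ_1 + ⋯ + λ_k`. -/
def totalRate (k : ℕ) (lam : ℕ → ℝ) : ℝ := ∑ j ∈ Finset.Icc 1 k, lam j

/-- The family `p j : ℝ → ℝ` (used on `[0, ∞)`) solves the Cauchy problem of the fractional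
difference-differential system of order `ν` with jump sizes `1, …, k` and rates
`lam 1, …, lam k`:
`d^ν p_j / dt^ν = ∑_{r=1}^{min(j,k)} λ_r p_{j-r} - Λ p_j` for `t > 0`, with `p_j(0) = δ_{j,0}`. -/
structure SolvesFractionalSystem (ν : ℝ) (k : ℕ) (lam : ℕ → ℝ) (p : ℕ → ℝ → ℝ) : Prop where
  continuousOn : ∀ j, ContinuousOn (p j) (Ici 0)
  initial : ∀ j, p j 0 = if j = 0 then 1 else 0
  equation : ∀ j, ∀ t : ℝ, 0 < t →
    HasCaputoDerivAt ν (p j)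
      (∑ r ∈ Finset.Icc 1 (min j k), lam r * p (j - r) t - totalRate k lam * p j t) t

/-- `M` is an `ℕ`-valued process whose one-dimensional probabilities
`p_j(t) = P(M(t) = j)` solve the fractional difference-differential system. -/
def IsFractionalCountingProcess {Ω : Type*} [MeasurableSpace Ω] (P : Measure Ω)
    (ν : ℝ) (k : ℕ) (lam : ℕ → ℝ) (M : ℝ≥0 → Ω → ℕ) : Prop :=
  (∀ t, Measurable (M t)) ∧
  SolvesFractionalSystem ν k lam (fun j t => P.real {ω | M t.toNNReal ω = j})

end

end FracCounting

/-!
Both families of probabilities satisfy the same Volterra system, which has a unique bounded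
solution. Let `I^ν` be the Riemann–Liouville integral `rlIntegral ν`, the convolution on the half
line with `rlKernel ν t = t ^ (ν - 1) / Γ(ν)`.

For the probabilities `p_j` of `M` and `ν < 1`, the Caputo derivative is `I^(1 - ν) p_j'`, and
`I^ν I^(1 - ν) p_j' = p_j - p_j(0)` by Fubini and Euler's Beta integral
(`rlIntegral_rlIntegral_of_add_eq_one`); for `ν = 1` this is the fundamental theorem of calculus.
Hence
`p_j = δ_{j,0} + I^ν (∑_r λ_r p_{j-r} - Λ p_j)` (`SolvesFractionalSystem.eq_add_rlIntegral`).

For the renewal process, termwise integration of the Mittag-Leffler series shows that the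
interarrival density `f` satisfies `f + Λ I^ν f = Λ rlKernel ν`
(`interarrivalDensity_add_rlIntegral`). Written as an identity between measures and convolved with
the law of the `n`-th arrival time, this becomes `F_{n+1} = Λ I^ν (F_n - F_{n+1})` for the
distribution functions `F_n` of the arrival times (`arrivalCdf_succ`). In particular `F_n → 0`
(`tendsto_arrivalCdf`), so that the arrival times tend to infinity, no explosion occurs and
`P(N(t) = n) = F_n(t) - F_{n+1}(t)`. Conditioning on `N(t)` and on the last summand, the
probabilities of the random sum are seen to satisfy the same system (`compoundProb_eq`).

The difference of two bounded solutions vanishes by induction on `j`: once the components below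
`j` agree, the difference `d` of the `j`-th ones satisfies `d = -Λ I^ν d`, and `Λ I^ν` is a
contraction in a norm with exponential weight (`eq_zero_of_eq_neg_mul_rlIntegral`,
`volterra_system_unique`). No Laplace transform is needed.
-/

namespace FracCounting

noncomputable section

/-! ### Riemann–Liouville kernels and integrals -/

/-- The Riemann–Liouville kernel `t ^ (a - 1) / Γ(a)` of order `a`. -/
def rlKernel (a t : ℝ) : ℝ := t ^ (a - 1) / Real.Gamma a

/-- The Riemann–Liouville fractional integral of order `a` with base point `0`. -/
def rlIntegral (a : ℝ) (f : ℝ → ℝ) (t : ℝ) : ℝ := ∫ s in (0 : ℝ)..t, rlKernel a (t - s) * f s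

lemma measurable_rlKernel (a : ℝ) : Measurable (rlKernel a) := by
  unfold rlKernel
  fun_prop

lemma rlKernel_nonneg {a t : ℝ} (ha : 0 < a) (ht : 0 ≤ t) : 0 ≤ rlKernel a t :=
  div_nonneg (Real.rpow_nonneg ht _) (Real.Gamma_pos_of_pos ha).le

lemma rlKernel_pos {a t : ℝ} (ha : 0 < a) (ht : 0 < t) : 0 < rlKernel a t :=
  div_pos (Real.rpow_pos_of_pos ht _) (Real.Gamma_pos_of_pos ha)

lemma rlKernel_one (t : ℝ) : rlKernel 1 t = 1 := by simp [rlKernel]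

lemma intervalIntegrable_rlKernel {a : ℝ} (ha : 0 < a) (x y : ℝ) :
    IntervalIntegrable (rlKernel a) volume x y :=
  (intervalIntegral.intervalIntegrable_rpow' (by linarith)).div_const _

lemma intervalIntegrable_rlKernel_sub {a : ℝ} (ha : 0 < a) (t : ℝ) :
    IntervalIntegrable (fun s => rlKernel a (t - s)) volume 0 t := by
  simpa using ((intervalIntegrable_rlKernel ha t 0).comp_sub_left t)

lemma intervalIntegrable_rlKernel_mul {a : ℝ} (ha : 0 < a) {t C : ℝ} (ht : 0 ≤ t) {f : ℝ → ℝ}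
    (hf : AEStronglyMeasurable f (volume.restrict (Ioc 0 t)))
    (hC : ∀ s ∈ Ioc 0 t, |f s| ≤ C) :
    IntervalIntegrable (fun s => rlKernel a (t - s) * f s) volume 0 t := by
  have h := intervalIntegrable_rlKernel_sub ha t
  rw [intervalIntegrable_iff_integrableOn_Ioc_of_le ht] at h ⊢
  refine Integrable.mul_bdd (c := C) h hf ?_
  filter_upwards [ae_restrict_mem measurableSet_Ioc] with s hs using hC s hs

/-- Euler's Beta integral, as the statement that the kernels of orders `a` and `b` convolve to the
kernel of order `a + b`. -/
lemma integral_rlKernel_mul_rlKernel {a b t : ℝ} (ha : 0 < a) (hb : 0 < b) (ht : 0 < t) :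
    ∫ s in (0 : ℝ)..t, rlKernel a (t - s) * rlKernel b s = rlKernel (a + b) t := by
  have h := Complex.betaIntegral_scaled (b : ℂ) (a : ℂ) ht
  have hG := Complex.Gamma_mul_Gamma_eq_betaIntegral (s := (b : ℂ)) (t := (a : ℂ))
    (by simpa using hb) (by simpa using ha)
  have hGa := (Real.Gamma_pos_of_pos ha).ne'
  have hGb := (Real.Gamma_pos_of_pos hb).ne'
  have hGab := (Real.Gamma_pos_of_pos (add_pos ha hb)).ne'
  have e : ∫ x in (0 : ℝ)..t, (x : ℂ) ^ ((b : ℂ) - 1) * ((t : ℂ) - x) ^ ((a : ℂ) - 1) =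
      ((∫ x in (0 : ℝ)..t, x ^ (b - 1) * (t - x) ^ (a - 1) : ℝ) : ℂ) := by
    rw [← intervalIntegral.integral_ofReal]
    refine intervalIntegral.integral_congr fun x hx => ?_
    rw [uIcc_of_le ht.le] at hx
    push_cast
    rw [Complex.ofReal_cpow hx.1, Complex.ofReal_cpow (sub_nonneg.2 hx.2)]
    push_cast
    rfl
  have e2 : Complex.betaIntegral b a =
      ((Real.Gamma b * Real.Gamma a / Real.Gamma (b + a) : ℝ) : ℂ) := by
    rw [Complex.Gamma_ofReal, Complex.Gamma_ofReal, ← Complex.ofReal_add, Complex.Gamma_ofReal]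
      at hG
    push_cast
    rw [hG, add_comm b a, mul_div_cancel_left₀]
    exact_mod_cast hGab
  rw [e, e2] at h
  have h' : (∫ x in (0 : ℝ)..t, x ^ (b - 1) * (t - x) ^ (a - 1)) =
      t ^ (b + a - 1) * (Real.Gamma b * Real.Gamma a / Real.Gamma (b + a)) := by
    apply Complex.ofReal_injective
    rw [h]
    push_cast
    rw [Complex.ofReal_cpow ht.le]
    push_cast
    rfl
  have : ∀ s, rlKernel a (t - s) * rlKernel b s =
      (Real.Gamma a * Real.Gamma b)⁻¹ * (s ^ (b - 1) * (t - s) ^ (a - 1)) := fun s => by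
    unfold rlKernel
    field_simp
  simp only [this]
  rw [intervalIntegral.integral_const_mul, h', rlKernel, add_comm b a]
  field_simp

lemma integral_rlKernel_sub_mul_rlKernel_sub {a b u t : ℝ} (ha : 0 < a) (hb : 0 < b)
    (hut : u < t) :
    ∫ s in u..t, rlKernel a (t - s) * rlKernel b (s - u) = rlKernel (a + b) (t - u) := by
  have h := intervalIntegral.integral_comp_sub_right (a := u) (b := t)
    (fun s => rlKernel a (t - u - s) * rlKernel b s) u
  rw [sub_self, integral_rlKernel_mul_rlKernel ha hb (sub_pos.2 hut)] at h
  rw [← h]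
  congr 1 with s
  congr 2
  ring

lemma intervalIntegrable_rlKernel_sub_mul_rlKernel_sub {a b u t : ℝ} (ha : 0 < a) (hb : 0 < b)
    (hut : u < t) :
    IntervalIntegrable (fun s => rlKernel a (t - s) * rlKernel b (s - u)) volume u t := by
  -- a Bochner integral with nonzero value forces integrability
  apply intervalIntegral.intervalIntegrable_of_integral_ne_zero
  rw [integral_rlKernel_sub_mul_rlKernel_sub ha hb hut]
  exact (rlKernel_pos (add_pos ha hb) (sub_pos.2 hut)).ne'

/-- The semigroup law for Riemann–Liouville integrals, in the case of total order one. -/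
lemma rlIntegral_rlIntegral_of_add_eq_one {a b t : ℝ} (ha : 0 < a) (hb : 0 < b) (hab : a + b = 1)
    (ht : 0 ≤ t) {f : ℝ → ℝ} (hf : IntervalIntegrable f volume 0 t) :
    rlIntegral a (rlIntegral b f) t = ∫ u in (0 : ℝ)..t, f u := by
  rw [intervalIntegrable_iff_integrableOn_Ioc_of_le ht] at hf
  set μ : Measure ℝ := volume.restrict (Ioc 0 t) with hμ
  -- the integrand over the triangle `u < s` in the square `(0, t] × (0, t]`; its integral in `s`
  -- is `rlKernel 1 = 1`, which makes Fubini applicable for every integrable `f`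
  let G : ℝ → ℝ → ℝ := fun u s =>
    (Ioi u).indicator (fun s => rlKernel a (t - s) * rlKernel b (s - u)) s
  have hset : ∀ u ∈ Ioc 0 t, Ioi u ∩ Ioc 0 t = Ioc u t := fun u hu => by
    ext s
    simp only [mem_inter_iff, mem_Ioi, mem_Ioc]
    exact ⟨fun h => ⟨h.1, h.2.2⟩, fun h => ⟨h.1, hu.1.trans h.1, h.2⟩⟩
  have hne : ∀ᵐ u ∂μ, u ∈ Ioc 0 t ∧ u < t := by
    filter_upwards [ae_restrict_mem measurableSet_Ioc,
      ae_restrict_of_ae (Measure.ae_ne volume t)] with u hu hut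
    exact ⟨hu, lt_of_le_of_ne hu.2 hut⟩
  have hGint : ∀ u, u ∈ Ioc 0 t → u < t → Integrable (G u) μ := fun u hu hut => by
    rw [integrable_indicator_iff measurableSet_Ioi, IntegrableOn, hμ,
      Measure.restrict_restrict measurableSet_Ioi, hset u hu]
    exact (intervalIntegrable_iff_integrableOn_Ioc_of_le hut.le).1
      (intervalIntegrable_rlKernel_sub_mul_rlKernel_sub ha hb hut)
  have hGval : ∀ u, u ∈ Ioc 0 t → u < t → ∫ s, G u s ∂μ = 1 := fun u hu hut => by
    rw [integral_indicator measurableSet_Ioi, hμ,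
      Measure.restrict_restrict measurableSet_Ioi, hset u hu,
      ← intervalIntegral.integral_of_le hut.le,
      integral_rlKernel_sub_mul_rlKernel_sub ha hb hut, hab, rlKernel_one]
  have hG0 : ∀ u s, s ∈ Ioc 0 t → 0 ≤ G u s := fun u s hs =>
    indicator_apply_nonneg fun hsu => mul_nonneg (rlKernel_nonneg ha (sub_nonneg.2 hs.2))
      (rlKernel_nonneg hb (sub_nonneg.2 (le_of_lt hsu)))
  have hGm : Measurable fun z : ℝ × ℝ => G z.2 z.1 := by
    have : (fun z : ℝ × ℝ => G z.2 z.1) =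
        {z : ℝ × ℝ | z.2 < z.1}.indicator
          (fun z => rlKernel a (t - z.1) * rlKernel b (z.1 - z.2)) := by
      ext z
      simp only [G, indicator_apply, mem_Ioi, mem_ofPred_eq]
    rw [this]
    refine Measurable.indicator ?_ (measurableSet_lt measurable_snd measurable_fst)
    exact ((measurable_rlKernel a).comp (measurable_const.sub measurable_fst)).mul
      ((measurable_rlKernel b).comp (measurable_fst.sub measurable_snd))
  have hint : Integrable (fun z : ℝ × ℝ => G z.2 z.1 * f z.2) (μ.prod μ) := by
    have hm : AEStronglyMeasurable (fun z : ℝ × ℝ => G z.2 z.1 * f z.2) (μ.prod μ) :=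
      hGm.aestronglyMeasurable.mul hf.1.comp_snd
    rw [integrable_prod_iff' hm]
    constructor
    · filter_upwards [hne] with u hu
      exact (hGint u hu.1 hu.2).mul_const _
    · refine hf.norm.congr ?_
      filter_upwards [hne] with u hu
      have : ∀ᵐ s ∂μ, ‖G u s * f u‖ = G u s * ‖f u‖ := by
        filter_upwards [ae_restrict_mem measurableSet_Ioc] with s hs
        rw [norm_mul, Real.norm_of_nonneg (hG0 u s hs)]
      rw [integral_congr_ae this, integral_mul_const, hGval u hu.1 hu.2, one_mul]
  have hswap := integral_integral_swap (f := fun s u => G u s * f u) hint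
  rw [rlIntegral, intervalIntegral.integral_of_le ht, intervalIntegral.integral_of_le ht]
  calc _ = ∫ s, ∫ u, G u s * f u ∂μ ∂μ := by
        refine setIntegral_congr_fun measurableSet_Ioc fun s hs => ?_
        have h1 : ∀ u, G u s * f u =
            (Iio s).indicator (fun u => rlKernel a (t - s) * (rlKernel b (s - u) * f u)) u := by
          intro u
          simp only [G, indicator_apply, mem_Ioi, mem_Iio]
          split_ifs <;> ring
        have h2 : Iio s ∩ Ioc 0 t = Ioo 0 s := by
          ext u
          simp only [mem_inter_iff, mem_Iio, mem_Ioc, mem_Ioo]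
          exact ⟨fun h => ⟨h.2.1, h.1⟩, fun h => ⟨h.2, h.1, h.2.le.trans hs.2⟩⟩
        simp only [h1]
        rw [integral_indicator measurableSet_Iio, hμ,
          Measure.restrict_restrict measurableSet_Iio, h2, ← integral_Ioc_eq_integral_Ioo,
          integral_const_mul, rlIntegral, intervalIntegral.integral_of_le hs.1.le]
    _ = ∫ u, ∫ s, G u s * f u ∂μ ∂μ := hswap
    _ = ∫ u, f u ∂μ := by
        refine integral_congr_ae ?_
        filter_upwards [hne] with u hu
        rw [integral_mul_const, hGval u hu.1 hu.2, one_mul]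

/-- A Caputo equation implies a Volterra equation, obtained by applying the Riemann–Liouville
integral of order `ν` to both sides. -/
lemma eq_add_rlIntegral_of_hasCaputoDerivAt {ν : ℝ} (hν₀ : 0 < ν) {f d : ℝ → ℝ}
    (hf : ContinuousOn f (Ici 0)) (hd : ContinuousOn d (Ici 0))
    (h : ∀ t, 0 < t → HasCaputoDerivAt ν f (d t) t) {t : ℝ} (ht : 0 ≤ t) :
    f t = f 0 + rlIntegral ν d t := by
  rcases ht.eq_or_lt with rfl | ht'
  · simp [rlIntegral]
  rcases h t ht' with ⟨rfl, -⟩ | ⟨hν, hac, -, -⟩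
  · have h1 : ∀ s ∈ Ioo 0 t, HasDerivAt f (d s) s := fun s hs => by
      rcases h s hs.1 with ⟨-, h'⟩ | ⟨h', -⟩
      · exact h'
      · exact absurd h' (lt_irrefl _)
    have h2 := intervalIntegral.integral_eq_sub_of_hasDerivAt_of_le ht
      (hf.mono Icc_subset_Ici_self) h1
      ((hd.mono Icc_subset_Ici_self).intervalIntegrable_of_Icc ht)
    simp only [rlIntegral, rlKernel_one, one_mul, h2]
    ring
  · have h1 : rlIntegral ν d t = rlIntegral ν (rlIntegral (1 - ν) (deriv f)) t := by
      rw [rlIntegral, rlIntegral, intervalIntegral.integral_of_le ht,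
        intervalIntegral.integral_of_le ht]
      refine setIntegral_congr_fun measurableSet_Ioc fun s hs => ?_
      rcases h s hs.1 with ⟨h', -⟩ | ⟨-, -, -, h'⟩
      · exact absurd h' hν.ne
      · rw [h', rlIntegral, ← intervalIntegral.integral_const_mul]
        congr 2 with u
        rw [rlKernel, sub_sub_cancel_left]
        ring
    rw [h1, rlIntegral_rlIntegral_of_add_eq_one hν₀ (sub_pos.2 hν) (by ring) ht
      hac.intervalIntegrable_deriv, hac.integral_deriv_eq_sub]
    ring

/-- A bounded solution of the homogeneous Volterra equation `d = -c I^ν d` vanishes. -/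
lemma eq_zero_of_eq_neg_mul_rlIntegral {ν c C : ℝ} (hν₀ : 0 < ν) (hc : 0 < c) {d : ℝ → ℝ}
    (hC : ∀ t, 0 ≤ t → |d t| ≤ C) (hd : ∀ t, 0 ≤ t → d t = -c * rlIntegral ν d t)
    {t : ℝ} (ht : 0 ≤ t) : d t = 0 := by
  -- in the norm `sup |d t| exp (-a t)` the operator `c I^ν` has norm at most `c a ^ (-ν)`,
  -- which is `1 / 2` for this choice of `a`
  set a : ℝ := (2 * c) ^ (1 / ν) with ha
  have ha0 : 0 < a := Real.rpow_pos_of_pos (by positivity) _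
  have haν : (1 / a) ^ ν = 1 / (2 * c) := by
    rw [Real.div_rpow zero_le_one ha0.le, Real.one_rpow, ha, ← Real.rpow_mul (by positivity),
      one_div_mul_cancel hν₀.ne', Real.rpow_one]
  have hC0 : 0 ≤ C := (abs_nonneg _).trans (hC 0 le_rfl)
  have hG := Real.Gamma_pos_of_pos hν₀
  have hker : ∀ t, 0 ≤ t →
      ∫ s in (0 : ℝ)..t, rlKernel ν s * Real.exp (-(a * s)) ≤ 1 / (2 * c) := fun t ht => by
    have hint := Real.integral_rpow_mul_exp_neg_mul_Ioi hν₀ ha0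
    have h0 : ∫ s in Ioi (0 : ℝ), rlKernel ν s * Real.exp (-(a * s)) = 1 / (2 * c) := by
      have : ∀ s, rlKernel ν s * Real.exp (-(a * s)) =
          (Real.Gamma ν)⁻¹ * (s ^ (ν - 1) * Real.exp (-(a * s))) := fun s => by
        unfold rlKernel
        ring
      simp only [this]
      rw [integral_const_mul, hint, haν]
      field_simp
    have hI : IntegrableOn (fun s => rlKernel ν s * Real.exp (-(a * s))) (Ioi 0) := by
      apply Integrable.of_integral_ne_zero
      rw [h0]
      positivity
    rw [intervalIntegral.integral_of_le ht, ← h0]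
    refine setIntegral_mono_set hI ?_ Ioc_subset_Ioi_self.eventuallyLE
    filter_upwards [ae_restrict_mem measurableSet_Ioi] with s hs
    exact mul_nonneg (rlKernel_nonneg hν₀ (le_of_lt hs)) (Real.exp_pos _).le
  have key : ∀ n : ℕ, ∀ t, 0 ≤ t → |d t| ≤ C * (1 / 2) ^ n * Real.exp (a * t) := by
    intro n
    induction n with
    | zero =>
      intro t ht
      have : 1 ≤ Real.exp (a * t) := Real.one_le_exp (by positivity)
      simpa using (hC t ht).trans (le_mul_of_one_le_right hC0 this)
    | succ n ih =>
      intro t ht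
      have hb : |rlIntegral ν d t| ≤ ∫ s in (0 : ℝ)..t,
          rlKernel ν (t - s) * (C * (1 / 2) ^ n * Real.exp (a * s)) := by
        rw [← Real.norm_eq_abs]
        refine intervalIntegral.norm_integral_le_of_norm_le ht ?_ ?_
        · refine Filter.Eventually.of_forall fun s hs => ?_
          have hk := rlKernel_nonneg hν₀ (sub_nonneg.2 hs.2)
          rw [norm_mul, Real.norm_of_nonneg hk]
          exact mul_le_mul_of_nonneg_left (ih s hs.1.le) hk
        · exact (intervalIntegrable_rlKernel_sub hν₀ t).mul_continuousOn (by fun_prop)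
      have hcomp := intervalIntegral.integral_comp_sub_left (a := 0) (b := t)
        (fun s => rlKernel ν s * Real.exp (-(a * s))) t
      rw [sub_self, sub_zero] at hcomp
      have he : ∫ s in (0 : ℝ)..t, rlKernel ν (t - s) * (C * (1 / 2) ^ n * Real.exp (a * s)) =
          C * (1 / 2) ^ n * Real.exp (a * t) *
            ∫ s in (0 : ℝ)..t, rlKernel ν s * Real.exp (-(a * s)) := by
        rw [← hcomp, ← intervalIntegral.integral_const_mul]
        congr 1 with s
        have : Real.exp (a * s) = Real.exp (a * t) * Real.exp (-(a * (t - s))) := by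
          rw [← Real.exp_add]
          ring_nf
        rw [this]
        ring
      rw [he] at hb
      rw [hd t ht, abs_mul, abs_neg, abs_of_pos hc]
      calc c * |rlIntegral ν d t| ≤ c * (C * (1 / 2) ^ n * Real.exp (a * t) * (1 / (2 * c))) := by
            gcongr
            exact hb.trans (mul_le_mul_of_nonneg_left (hker t ht) (by positivity))
        _ = C * (1 / 2) ^ (n + 1) * Real.exp (a * t) := by
            field_simp
            ring
  have hlim : Filter.Tendsto (fun n : ℕ => C * (1 / 2) ^ n * Real.exp (a * t)) Filter.atTop
      (nhds (C * 0 * Real.exp (a * t))) :=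
    ((tendsto_pow_atTop_nhds_zero_of_lt_one (by norm_num) (by norm_num)).const_mul C).mul_const _
  have := ge_of_tendsto' hlim fun n => key n t ht
  rw [mul_zero, zero_mul] at this
  exact abs_nonpos_iff.1 this

/-- Uniqueness for the Volterra form of the fractional difference-differential system, among
bounded measurable families. -/
lemma volterra_system_unique {ν c : ℝ} (hν₀ : 0 < ν) (hc : 0 < c) (k : ℕ) (lam : ℕ → ℝ)
    {v w : ℕ → ℝ → ℝ}
    (hvm : ∀ j, AEStronglyMeasurable (v j) (volume.restrict (Ioi 0)))
    (hwm : ∀ j, AEStronglyMeasurable (w j) (volume.restrict (Ioi 0)))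
    (hvb : ∀ j, ∃ C, ∀ t, 0 ≤ t → |v j t| ≤ C) (hwb : ∀ j, ∃ C, ∀ t, 0 ≤ t → |w j t| ≤ C)
    (hv : ∀ j t, 0 ≤ t → v j t = (if j = 0 then 1 else 0) +
      rlIntegral ν (fun s => ∑ r ∈ Finset.Icc 1 (min j k), lam r * v (j - r) s - c * v j s) t)
    (hw : ∀ j t, 0 ≤ t → w j t = (if j = 0 then 1 else 0) +
      rlIntegral ν (fun s => ∑ r ∈ Finset.Icc 1 (min j k), lam r * w (j - r) s - c * w j s) t)
    (j : ℕ) : ∀ t, 0 ≤ t → v j t = w j t := by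
  induction j using Nat.strong_induction_on with
  | _ j ih =>
  obtain ⟨C, hC⟩ := hvb j
  obtain ⟨D, hD⟩ := hwb j
  have hsub : ∀ t, (Ioc (0 : ℝ) t) ⊆ Ioi 0 := fun t => Ioc_subset_Ioi_self
  have key : ∀ t, 0 ≤ t → v j t - w j t = -c * rlIntegral ν (fun s => v j s - w j s) t := by
    intro t ht
    have hS : ∀ s ∈ Ioc 0 t, ∑ r ∈ Finset.Icc 1 (min j k), lam r * v (j - r) s =
        ∑ r ∈ Finset.Icc 1 (min j k), lam r * w (j - r) s := fun s hs => by
      refine Finset.sum_congr rfl fun r hr => ?_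
      rw [Finset.mem_Icc, le_min_iff] at hr
      rw [ih (j - r) (by omega) s hs.1.le]
    have hbd : ∀ (z : ℕ → ℝ → ℝ),
        (∀ i, AEStronglyMeasurable (z i) (volume.restrict (Ioi 0))) →
        (∀ i, ∃ C, ∀ t, 0 ≤ t → |z i t| ≤ C) →
        IntervalIntegrable (fun s => rlKernel ν (t - s) *
          (∑ r ∈ Finset.Icc 1 (min j k), lam r * z (j - r) s - c * z j s)) volume 0 t := by
      intro z hzm hzb
      have hi : ∀ i, IntervalIntegrable (fun s => rlKernel ν (t - s) * z i s) volume 0 t :=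
        fun i => by
          obtain ⟨B, hB⟩ := hzb i
          exact intervalIntegrable_rlKernel_mul hν₀ ht
            ((hzm i).mono_measure (Measure.restrict_mono (hsub t) le_rfl))
            fun s hs => hB s hs.1.le
      have : (fun s => rlKernel ν (t - s) *
          (∑ r ∈ Finset.Icc 1 (min j k), lam r * z (j - r) s - c * z j s)) =
          fun s => ∑ r ∈ Finset.Icc 1 (min j k), lam r * (rlKernel ν (t - s) * z (j - r) s)
            - c * (rlKernel ν (t - s) * z j s) := by
        ext s
        rw [mul_sub, Finset.mul_sum]
        congr 1
        · exact Finset.sum_congr rfl fun r _ => by ring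
        · ring
      rw [this]
      refine IntervalIntegrable.sub ?_ ((hi j).const_mul c)
      simpa only [Finset.sum_fn] using IntervalIntegrable.sum (Finset.Icc 1 (min j k))
        (f := fun r s => lam r * (rlKernel ν (t - s) * z (j - r) s))
        fun r _ => (hi (j - r)).const_mul (lam r)
    rw [hv j t ht, hw j t ht, add_sub_add_left_eq_sub, rlIntegral, rlIntegral, rlIntegral,
      ← intervalIntegral.integral_sub (hbd v hvm hvb) (hbd w hwm hwb),
      ← intervalIntegral.integral_const_mul, intervalIntegral.integral_of_le ht,
      intervalIntegral.integral_of_le ht]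
    refine setIntegral_congr_fun measurableSet_Ioc fun s hs => ?_
    simp only [hS s hs]
    ring
  intro t ht
  refine sub_eq_zero.1 (eq_zero_of_eq_neg_mul_rlIntegral hν₀ hc (C := C + D)
    (d := fun s => v j s - w j s) (fun s hs => ?_) key ht)
  exact (abs_sub _ _).trans (add_le_add (hC s hs) (hD s hs))

/-! ### The renewal density -/

/-- A lower bound for `Γ` that beats every geometric sequence, `T` being arbitrary. -/
lemma rpow_mul_exp_neg_le_Gamma {s T : ℝ} (hs : 1 ≤ s) (hT : 0 < T) :
    T ^ (s - 1) * Real.exp (-T) ≤ Real.Gamma s := by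
  have h := Real.GammaIntegral_convergent (zero_lt_one.trans_le hs)
  rw [Real.Gamma_eq_integral (zero_lt_one.trans_le hs), ← integral_exp_neg_Ioi,
    ← integral_const_mul]
  have hsub : Ioi T ⊆ Ioi 0 := Ioi_subset_Ioi hT.le
  calc ∫ x in Ioi T, T ^ (s - 1) * Real.exp (-x)
      ≤ ∫ x in Ioi T, Real.exp (-x) * x ^ (s - 1) := by
        refine setIntegral_mono_on ((integrableOn_exp_neg_Ioi T).const_mul _) (h.mono_set hsub)
          measurableSet_Ioi fun x hx => ?_
        rw [mul_comm]
        exact mul_le_mul_of_nonneg_left (Real.rpow_le_rpow hT.le (le_of_lt hx) (by linarith))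
          (Real.exp_pos _).le
    _ ≤ ∫ x in Ioi 0, Real.exp (-x) * x ^ (s - 1) := by
        refine setIntegral_mono_set h ?_ hsub.eventuallyLE
        filter_upwards [ae_restrict_mem measurableSet_Ioi] with x hx
        exact mul_nonneg (Real.exp_pos _).le (Real.rpow_nonneg (le_of_lt hx) _)

lemma summable_mittagLeffler {α β : ℝ} (hα : 0 < α) (x : ℝ) :
    Summable fun r : ℕ => x ^ r / Real.Gamma (α * r + β) := by
  -- with this `T` the bound `1 / Γ(s) ≤ exp T * T ^ (1 - s)` gives a geometric series of ratio
  -- `|x| / (|x| + 1)`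
  set T : ℝ := (|x| + 1) ^ (1 / α) with hT
  have hx : 0 < |x| + 1 := by positivity
  have hT0 : 0 < T := Real.rpow_pos_of_pos hx _
  have hTα : T ^ α = |x| + 1 := by
    rw [hT, ← Real.rpow_mul hx.le, one_div_mul_cancel hα.ne', Real.rpow_one]
  have hg : Summable fun r : ℕ => Real.exp T * T ^ (1 - β) * (|x| / (|x| + 1)) ^ r :=
    (summable_geometric_of_lt_one (by positivity) (by rw [div_lt_one hx]; linarith)).mul_left _
  obtain ⟨n, hn⟩ := exists_nat_ge ((1 - β) / α)
  refine hg.of_norm_bounded_eventually_nat ?_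
  filter_upwards [Filter.eventually_ge_atTop n] with r hr
  have h1 : 1 ≤ α * r + β := by
    have : (1 - β) / α ≤ r := hn.trans (by exact_mod_cast hr)
    rw [div_le_iff₀ hα] at this
    linarith
  have hG := rpow_mul_exp_neg_le_Gamma h1 hT0
  have hpos : 0 < T ^ (α * r + β - 1) * Real.exp (-T) := by positivity
  rw [norm_div, norm_pow, Real.norm_eq_abs, Real.norm_of_nonneg (hpos.le.trans hG)]
  refine (div_le_div_of_nonneg_left (by positivity) hpos hG).trans (le_of_eq ?_)
  have e : T ^ (α * r + β - 1) = (|x| + 1) ^ r * T ^ (β - 1) := by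
    rw [add_sub_assoc, Real.rpow_add hT0, Real.rpow_mul hT0.le, hTα, Real.rpow_natCast]
  have e2 : T ^ (1 - β) = (T ^ (β - 1))⁻¹ := by
    rw [← Real.rpow_neg hT0.le, neg_sub]
  rw [e, e2, Real.exp_neg, div_pow]
  field_simp

lemma pow_mul_rlKernel {ν c t : ℝ} (ht : 0 < t) (r : ℕ) (β : ℝ) :
    c ^ r * rlKernel (ν * r + β) t =
      t ^ (β - 1) * ((c * t ^ ν) ^ r / Real.Gamma (ν * r + β)) := by
  rw [rlKernel, add_sub_assoc, Real.rpow_add ht, Real.rpow_mul ht.le, Real.rpow_natCast, mul_pow]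
  ring

lemma summable_pow_mul_rlKernel {ν β t : ℝ} (hν : 0 < ν) (c : ℝ) (ht : 0 < t) :
    Summable fun r : ℕ => c ^ r * rlKernel (ν * r + β) t := by
  simp only [pow_mul_rlKernel ht]
  exact (summable_mittagLeffler hν _).mul_left _

lemma interarrivalDensity_eq_tsum {ν lam t : ℝ} (ht : 0 < t) :
    interarrivalDensity ν lam t = lam * ∑' r : ℕ, (-lam) ^ r * rlKernel (ν * r + ν) t := by
  simp only [pow_mul_rlKernel ht]
  rw [tsum_mul_left, interarrivalDensity, mittagLeffler, mul_assoc]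

/-- The renewal equation of the interarrival density `f`: `f + λ I^ν f = λ t ^ (ν - 1) / Γ(ν)`.
In terms of Laplace transforms, `f` has transform `λ / (s ^ ν + λ)`. -/
lemma interarrivalDensity_add_rlIntegral {ν lam t : ℝ} (hν : 0 < ν) (hlam : 0 < lam)
    (ht : 0 < t) :
    interarrivalDensity ν lam t + lam * rlIntegral ν (interarrivalDensity ν lam) t =
      lam * rlKernel ν t := by
  set μ : Measure ℝ := volume.restrict (Ioc 0 t)
  have hpos : ∀ r : ℕ, 0 < ν * r + ν := fun r => by positivity
  let F : ℕ → ℝ → ℝ := fun r s =>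
    (-lam) ^ r * (rlKernel ν (t - s) * rlKernel (ν * r + ν) s)
  have hF : ∀ r, Integrable (F r) μ := fun r => by
    have := intervalIntegrable_rlKernel_sub_mul_rlKernel_sub hν (hpos r) ht
    rw [intervalIntegrable_iff_integrableOn_Ioc_of_le ht.le] at this
    simpa only [sub_zero] using Integrable.const_mul this ((-lam) ^ r)
  have hval : ∀ r : ℕ, ∫ s, rlKernel ν (t - s) * rlKernel (ν * r + ν) s ∂μ =
      rlKernel (ν * r + (ν + ν)) t := fun r => by
    rw [← intervalIntegral.integral_of_le ht.le, integral_rlKernel_mul_rlKernel hν (hpos r) ht]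
    congr 1
    ring
  have hsum : Summable fun r => ∫ s, ‖F r s‖ ∂μ := by
    refine (summable_pow_mul_rlKernel (β := ν + ν) hν lam ht).congr fun r => ?_
    rw [← hval r, ← integral_const_mul]
    refine setIntegral_congr_fun measurableSet_Ioc fun s hs => ?_
    simp only [F]
    rw [norm_mul, norm_pow, norm_neg, Real.norm_of_nonneg hlam.le, Real.norm_of_nonneg]
    exact mul_nonneg (rlKernel_nonneg hν (sub_nonneg.2 hs.2)) (rlKernel_nonneg (hpos r) hs.1.le)
  have h := (hasSum_integral_of_summable_integral_norm hF hsum).tsum_eq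
  have hI : rlIntegral ν (interarrivalDensity ν lam) t =
      lam * ∑' r : ℕ, (-lam) ^ r * rlKernel (ν * r + (ν + ν)) t := by
    have e : ∀ r : ℕ, ∫ s, F r s ∂μ = (-lam) ^ r * rlKernel (ν * r + (ν + ν)) t := fun r => by
      rw [← hval r, ← integral_const_mul]
    simp only [e] at h
    rw [h, rlIntegral, intervalIntegral.integral_of_le ht.le, ← integral_const_mul]
    refine setIntegral_congr_fun measurableSet_Ioc fun s hs => ?_
    simp only [F]
    rw [interarrivalDensity_eq_tsum hs.1, mul_left_comm, ← tsum_mul_left]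
    congr 2 with r
    ring
  rw [hI, interarrivalDensity_eq_tsum ht,
    (summable_pow_mul_rlKernel (β := ν) hν (-lam) ht).tsum_eq_zero_add]
  have e : ∀ r : ℕ, (-lam) ^ (r + 1) * rlKernel (ν * (r + 1 : ℕ) + ν) t =
      -lam * ((-lam) ^ r * rlKernel (ν * r + (ν + ν)) t) := fun r => by
    have : ν * (r + 1 : ℕ) + ν = ν * r + (ν + ν) := by
      push_cast
      ring
    rw [this, pow_succ]
    ring
  simp only [e, tsum_mul_left]
  simp
  ring

lemma integrableOn_rlKernel_mul_interarrivalDensity {ν lam t : ℝ} (hν : 0 < ν)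
    (hlam : 0 < lam) (ht : 0 < t)
    (hm : AEStronglyMeasurable (interarrivalDensity ν lam) (volume.restrict (Ioi 0))) :
    IntegrableOn (fun s => rlKernel ν (t - s) * interarrivalDensity ν lam s) (Ioc 0 t) := by
  have hG := Real.Gamma_pos_of_pos hν
  -- near `0` the density is of the order of the kernel of order `ν`
  set K : ℝ := lam * (Real.Gamma ν * ∑' r : ℕ, (lam * t ^ ν) ^ r / Real.Gamma (ν * r + ν))
  have hb : ∀ s ∈ Ioc 0 t, |interarrivalDensity ν lam s| ≤ K * rlKernel ν s := fun s hs => by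
    have h1 : |mittagLeffler ν ν (-lam * s ^ ν)| ≤
        ∑' r : ℕ, (lam * t ^ ν) ^ r / Real.Gamma (ν * r + ν) := by
      rw [mittagLeffler, ← Real.norm_eq_abs]
      refine tsum_of_norm_bounded (summable_mittagLeffler hν _).hasSum fun r => ?_
      have hGr : 0 < Real.Gamma (ν * r + ν) := Real.Gamma_pos_of_pos (by positivity)
      rw [norm_div, norm_pow, norm_mul, norm_neg, Real.norm_of_nonneg hlam.le,
        Real.norm_of_nonneg (Real.rpow_nonneg hs.1.le _), Real.norm_of_nonneg hGr.le]
      have := hs.1.le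
      gcongr
      exact hs.2
    have h2 : 0 ≤ s ^ (ν - 1) := Real.rpow_nonneg hs.1.le _
    rw [interarrivalDensity, abs_mul, abs_mul, abs_of_pos hlam, abs_of_nonneg h2]
    calc _ ≤ lam * s ^ (ν - 1) *
          ∑' r : ℕ, (lam * t ^ ν) ^ r / Real.Gamma (ν * r + ν) := by gcongr
      _ = K * rlKernel ν s := by
          simp only [K, rlKernel]
          field_simp
  have hI := intervalIntegrable_rlKernel_sub_mul_rlKernel_sub hν hν ht
  rw [intervalIntegrable_iff_integrableOn_Ioc_of_le ht.le] at hI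
  refine (Integrable.const_mul hI K).mono' ?_ ?_
  · exact AEStronglyMeasurable.mul
      ((measurable_rlKernel ν).comp (measurable_const.sub measurable_id)).aestronglyMeasurable
      (hm.mono_measure (Measure.restrict_mono Ioc_subset_Ioi_self le_rfl))
  · filter_upwards [ae_restrict_mem measurableSet_Ioc] with s hs
    have hk := rlKernel_nonneg hν (sub_nonneg.2 hs.2)
    rw [norm_mul, Real.norm_of_nonneg hk, sub_zero, mul_left_comm]
    exact mul_le_mul_of_nonneg_left (hb s hs) hk

/-! ### The renewal equation for measures -/

/-- The measure on `(0, ∞)` whose density is the Riemann–Liouville kernel of order `ν`. -/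
def rlMeasure (ν : ℝ) : Measure ℝ :=
  volume.withDensity ((Ioi 0).indicator fun t => ENNReal.ofReal (rlKernel ν t))

instance (ν : ℝ) : SFinite (rlMeasure ν) := by
  unfold rlMeasure
  infer_instance

lemma measurable_rlMeasure_density (ν : ℝ) :
    Measurable ((Ioi (0 : ℝ)).indicator fun t => ENNReal.ofReal (rlKernel ν t)) :=
  (measurable_rlKernel ν).ennreal_ofReal.indicator measurableSet_Ioi

/-- Integrating the distribution function of a measure `m` on `[0, ∞)` fractionally is convolving
`m` with `rlMeasure`. -/
lemma rlMeasure_conv_Iic {ν : ℝ} (hν : 0 < ν) (m : Measure ℝ) [IsProbabilityMeasure m]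
    (hm : m (Iio 0) = 0) {t : ℝ} (ht : 0 ≤ t) :
    (rlMeasure ν ∗ m) (Iic t) = ENNReal.ofReal (rlIntegral ν (fun s => m.real (Iic s)) t) := by
  have hmono : Monotone fun s => m.real (Iic s) := fun a b hab =>
    measureReal_mono (Iic_subset_Iic.2 hab)
  have hint := intervalIntegrable_rlKernel_mul hν (C := 1) ht
    (hmono.measurable.aestronglyMeasurable (μ := volume.restrict (Ioc 0 t)))
    fun s _ => by
      rw [abs_of_nonneg measureReal_nonneg]
      exact measureReal_le_one
  have hnn : 0 ≤ᵐ[volume.restrict (Ioc 0 t)] fun s => rlKernel ν (t - s) * m.real (Iic s) := by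
    filter_upwards [ae_restrict_mem measurableSet_Ioc] with s hs
    exact mul_nonneg (rlKernel_nonneg hν (sub_nonneg.2 hs.2)) measureReal_nonneg
  rw [intervalIntegrable_iff_integrableOn_Ioc_of_le ht] at hint
  rw [rlIntegral, intervalIntegral.integral_of_le ht, ofReal_integral_eq_lintegral_ofReal hint hnn]
  have h1 : (rlMeasure ν ∗ m) (Iic t) = ∫⁻ x, m (Iic (t - x)) ∂(rlMeasure ν) := by
    rw [Measure.conv, Measure.map_apply measurable_add measurableSet_Iic,
      Measure.prod_apply (measurable_add measurableSet_Iic)]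
    refine lintegral_congr fun x => ?_
    congr 1
    ext y
    simp [le_sub_iff_add_le']
  have hmeas : Measurable fun x => m (Iic (t - x)) := by
    have : Antitone fun x => m (Iic (t - x)) := fun a b hab =>
      measure_mono (Iic_subset_Iic.2 (by linarith))
    exact this.measurable
  rw [h1, rlMeasure,
    lintegral_withDensity_eq_lintegral_mul _ (measurable_rlMeasure_density ν) hmeas,
    ← lintegral_sub_left_eq_self _ t, ← lintegral_indicator measurableSet_Ioc]
  refine lintegral_congr_ae ?_
  filter_upwards [Measure.ae_ne volume 0, Measure.ae_ne volume t] with s hs0 hst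
  simp only [Pi.mul_apply, sub_sub_cancel]
  by_cases hs : s ∈ Ioc 0 t
  · rw [indicator_of_mem hs, indicator_of_mem
      (show t - s ∈ Ioi (0 : ℝ) from sub_pos.2 (lt_of_le_of_ne hs.2 hst)),
      ENNReal.ofReal_mul (rlKernel_nonneg hν (sub_nonneg.2 hs.2)), ofReal_measureReal]
  · rw [indicator_of_notMem hs]
    by_cases hs' : s < 0
    · rw [measure_mono_null (Iic_subset_Iio.2 hs') hm, mul_zero]
    · rw [indicator_of_notMem, zero_mul]
      intro h
      exact hs ⟨lt_of_le_of_ne (not_lt.1 hs') hs0.symm, (sub_pos.1 h).le⟩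

section Law

variable {Ω : Type*} [MeasurableSpace Ω] {P : Measure Ω} [IsProbabilityMeasure P] {U : Ω → ℝ}
  {f : ℝ → ℝ}

lemma HasDensityOnPos.integrableOn (h : HasDensityOnPos P U f) : IntegrableOn f (Ioi 0) := by
  -- the total integral is `1`, hence not the default value of a divergent integral
  apply Integrable.of_integral_ne_zero
  have := h univ MeasurableSet.univ
  rw [univ_inter, preimage_univ, probReal_univ] at this
  simp [← this]

lemma HasDensityOnPos.ae_nonneg (h : HasDensityOnPos P U f) :
    0 ≤ᵐ[volume.restrict (Ioi 0)] f :=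
  ae_nonneg_restrict_of_forall_setIntegral_nonneg_inter h.integrableOn fun s hs _ => by
    rw [← h s hs]
    exact measureReal_nonneg

lemma HasDensityOnPos.map_eq (h : HasDensityOnPos P U f) (hU : Measurable U) :
    P.map U = volume.withDensity ((Ioi 0).indicator fun t => ENNReal.ofReal (f t)) := by
  ext B hB
  rw [withDensity_apply _ hB, Measure.map_apply hU hB, lintegral_indicator measurableSet_Ioi,
    Measure.restrict_restrict measurableSet_Ioi, inter_comm, ← ofReal_measureReal, h B hB,
    ofReal_integral_eq_lintegral_ofReal (h.integrableOn.mono_set inter_subset_right)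
      (ae_restrict_of_ae_restrict_of_subset inter_subset_right h.ae_nonneg)]

lemma HasDensityOnPos.ae_pos (h : HasDensityOnPos P U f) : ∀ᵐ ω ∂P, 0 < U ω := by
  have := h (Iic 0) measurableSet_Iic
  rw [Iic_inter_Ioi, Ioc_self, setIntegral_empty, measureReal_eq_zero_iff] at this
  rw [ae_iff]
  simpa [preimage] using this

/-- The renewal equation `μ + λ μ * γ = λ γ` for the interarrival law `μ`, where `γ` is the
measure with density `t ^ (ν - 1) / Γ(ν)`. -/
lemma map_add_smul_conv_rlMeasure {ν lam : ℝ} (hν : 0 < ν) (hlam : 0 < lam) (hU : Measurable U)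
    (h : HasDensityOnPos P U (interarrivalDensity ν lam)) :
    P.map U + ENNReal.ofReal lam • (P.map U ∗ rlMeasure ν) =
      ENNReal.ofReal lam • rlMeasure ν := by
  set φ : ℝ → ENNReal :=
    (Ioi 0).indicator fun t => ENNReal.ofReal (interarrivalDensity ν lam t) with hφ
  set κ : ℝ → ENNReal := (Ioi 0).indicator fun t => ENNReal.ofReal (rlKernel ν t) with hκ
  have hφm : AEMeasurable φ volume :=
    (aemeasurable_indicator_iff measurableSet_Ioi).2 h.integrableOn.aemeasurable.ennreal_ofReal
  have hκm : Measurable κ := measurable_rlMeasure_density ν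
  have hnn := (ae_restrict_iff' measurableSet_Ioi).1 h.ae_nonneg
  rw [h.map_eq hU, rlMeasure, conv_withDensity_eq_mlconvolution₀ hφm hκm.aemeasurable,
    ← withDensity_smul' _ _ ENNReal.ofReal_ne_top, ← withDensity_smul _ hκm]
  have hadd : ∀ ψ : ℝ → ENNReal, volume.withDensity φ + volume.withDensity ψ =
      volume.withDensity (φ + ψ) := fun ψ => by
    ext s hs
    rw [Measure.add_apply, withDensity_apply _ hs, withDensity_apply _ hs, withDensity_apply _ hs,
      ← lintegral_add_left' hφm.restrict]
    rfl
  rw [hadd]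
  refine withDensity_congr_ae ?_
  filter_upwards [hnn] with t ht
  simp only [Pi.add_apply, Pi.smul_apply, smul_eq_mul, lconvolution_def]
  by_cases ht0 : 0 < t
  · have hI := integrableOn_rlKernel_mul_interarrivalDensity hν hlam ht0 h.integrableOn.1
    have hI0 : 0 ≤ᵐ[volume.restrict (Ioc 0 t)]
        fun s => rlKernel ν (t - s) * interarrivalDensity ν lam s := by
      filter_upwards [ae_restrict_mem measurableSet_Ioc,
        ae_restrict_of_ae_restrict_of_subset Ioc_subset_Ioi_self h.ae_nonneg] with s hs hs'
      exact mul_nonneg (rlKernel_nonneg hν (sub_nonneg.2 hs.2)) hs'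
    have hconv : ∫⁻ s, φ s * κ (-s + t) =
        ENNReal.ofReal (rlIntegral ν (interarrivalDensity ν lam) t) := by
      rw [rlIntegral, intervalIntegral.integral_of_le ht0.le,
        ofReal_integral_eq_lintegral_ofReal hI hI0, ← lintegral_indicator measurableSet_Ioc]
      refine lintegral_congr_ae ?_
      filter_upwards [Measure.ae_ne volume t] with s hst
      rw [neg_add_eq_sub]
      by_cases hs : s ∈ Ioc 0 t
      · rw [indicator_of_mem hs, hφ, hκ, indicator_of_mem (show s ∈ Ioi (0 : ℝ) from hs.1),
          indicator_of_mem
            (show t - s ∈ Ioi (0 : ℝ) from sub_pos.2 (lt_of_le_of_ne hs.2 hst)),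
          ENNReal.ofReal_mul (rlKernel_nonneg hν (sub_nonneg.2 hs.2)), mul_comm]
      · rw [indicator_of_notMem hs]
        by_cases hs0 : 0 < s
        · rw [hκ, indicator_of_notMem (show t - s ∉ Ioi (0 : ℝ) from
            fun h' => hs ⟨hs0, (sub_pos.1 h').le⟩), mul_zero]
        · rw [hφ, indicator_of_notMem (show s ∉ Ioi (0 : ℝ) from hs0), zero_mul]
    have hI0' : 0 ≤ rlIntegral ν (interarrivalDensity ν lam) t := by
      rw [rlIntegral, intervalIntegral.integral_of_le ht0.le]
      exact integral_nonneg_of_ae hI0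
    rw [hconv, hφ, hκ, indicator_of_mem (show t ∈ Ioi (0 : ℝ) from ht0),
      indicator_of_mem (show t ∈ Ioi (0 : ℝ) from ht0), ← ENNReal.ofReal_mul hlam.le,
      ← ENNReal.ofReal_add (ht ht0) (by positivity), ← ENNReal.ofReal_mul hlam.le,
      interarrivalDensity_add_rlIntegral hν hlam ht0]
  · have hz : ∀ s, φ s * κ (-s + t) = 0 := fun s => by
      by_cases hs0 : 0 < s
      · rw [hκ, indicator_of_notMem, mul_zero]
        simp only [mem_Ioi, not_lt]
        linarith [not_lt.1 ht0]
      · rw [hφ, indicator_of_notMem (show s ∉ Ioi (0 : ℝ) from hs0), zero_mul]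
    simp only [hz]
    rw [hφ, hκ, indicator_of_notMem (show t ∉ Ioi (0 : ℝ) from ht0),
      indicator_of_notMem (show t ∉ Ioi (0 : ℝ) from ht0)]
    simp

/-- If `F` is the distribution function of a law on `[0, ∞)` and `F'` that of its convolution with
the interarrival law, then `F' = λ I^ν (F - F')`. -/
lemma real_conv_Iic_eq_rlIntegral {ν lam : ℝ} (hν : 0 < ν) (hlam : 0 < lam) (hU : Measurable U)
    (h : HasDensityOnPos P U (interarrivalDensity ν lam)) (m : Measure ℝ) [IsProbabilityMeasure m]
    (hm : m (Iio 0) = 0) (hm' : (m ∗ P.map U) (Iio 0) = 0) {t : ℝ} (ht : 0 ≤ t) :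
    (m ∗ P.map U).real (Iic t) =
      lam * rlIntegral ν (fun s => m.real (Iic s) - (m ∗ P.map U).real (Iic s)) t := by
  have : IsProbabilityMeasure (P.map U) := Measure.isProbabilityMeasure_map hU.aemeasurable
  have key := congrArg (fun ρ => (ρ ∗ m) (Iic t)) (map_add_smul_conv_rlMeasure hν hlam hU h)
  rw [Measure.add_conv, Measure.conv_smul_left, Measure.conv_smul_left,
    Measure.conv_comm (P.map U) (rlMeasure ν), Measure.conv_assoc, Measure.conv_comm (P.map U) m,
    Measure.add_apply, Measure.smul_apply, Measure.smul_apply, rlMeasure_conv_Iic hν m hm ht,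
    rlMeasure_conv_Iic hν _ hm' ht, smul_eq_mul, smul_eq_mul] at key
  have hint : ∀ (m : Measure ℝ) [IsProbabilityMeasure m],
      IntervalIntegrable (fun s => rlKernel ν (t - s) * m.real (Iic s)) volume 0 t := fun m _ => by
    have hmono : Monotone fun s => m.real (Iic s) := fun a b hab =>
      measureReal_mono (Iic_subset_Iic.2 hab)
    refine intervalIntegrable_rlKernel_mul hν (C := 1) ht
      hmono.measurable.aestronglyMeasurable fun s _ => ?_
    rw [abs_of_nonneg measureReal_nonneg]
    exact measureReal_le_one
  have hnn : ∀ (m : Measure ℝ), 0 ≤ rlIntegral ν (fun s => m.real (Iic s)) t := fun m =>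
    intervalIntegral.integral_nonneg ht fun s hs =>
      mul_nonneg (rlKernel_nonneg hν (sub_nonneg.2 hs.2)) measureReal_nonneg
  rw [← ofReal_measureReal, ← ENNReal.ofReal_mul hlam.le, ← ENNReal.ofReal_mul hlam.le,
    ← ENNReal.ofReal_add measureReal_nonneg (mul_nonneg hlam.le (hnn _)),
    ENNReal.ofReal_eq_ofReal_iff (add_nonneg measureReal_nonneg (mul_nonneg hlam.le (hnn _)))
      (mul_nonneg hlam.le (hnn _))] at key
  have hsub : rlIntegral ν (fun s => m.real (Iic s) - (m ∗ P.map U).real (Iic s)) t =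
      rlIntegral ν (fun s => m.real (Iic s)) t -
        rlIntegral ν (fun s => (m ∗ P.map U).real (Iic s)) t := by
    simp only [rlIntegral]
    rw [← intervalIntegral.integral_sub (hint m) (hint _)]
    simp only [mul_sub]
  rw [hsub]
  linarith

end Law

/-! ### Arrival times and the renewal count -/

lemma renewalCount_eq_of_le_of_lt {u : ℕ → ℝ} (hu : ∀ i, 0 < u i) {t : ℝ} {n : ℕ}
    (h1 : ∑ i ∈ Finset.range n, u i ≤ t) (h2 : t < ∑ i ∈ Finset.range (n + 1), u i) :
    renewalCount u t = n := by
  have hmono : Monotone fun n => ∑ i ∈ Finset.range n, u i :=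
    monotone_nat_of_le_succ fun n => by
      rw [Finset.sum_range_succ]
      linarith [hu n]
  have : {m : ℕ | ∑ i ∈ Finset.range (m + 1), u i ≤ t} = Finset.range n := by
    ext m
    simp only [mem_ofPred_eq, Finset.coe_range, mem_Iio]
    refine ⟨fun h => ?_, fun h => (hmono h).trans h1⟩
    by_contra! hnm
    exact (h2.trans_le (hmono (Nat.succ_le_succ hnm))).not_ge h
  rw [renewalCount, this, ncard_coe_finset, Finset.card_range]

lemma renewalCount_eq_iff {u : ℕ → ℝ} (hu : ∀ i, 0 < u i) {t : ℝ} (ht : 0 ≤ t)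
    (hex : ∃ n, t < ∑ i ∈ Finset.range n, u i) {n : ℕ} :
    renewalCount u t = n ↔
      ∑ i ∈ Finset.range n, u i ≤ t ∧ t < ∑ i ∈ Finset.range (n + 1), u i := by
  refine ⟨fun h => ?_, fun h => renewalCount_eq_of_le_of_lt hu h.1 h.2⟩
  obtain ⟨m, hm⟩ : ∃ m, Nat.find hex = m + 1 := by
    refine Nat.exists_eq_succ_of_ne_zero fun h0 => ?_
    have := Nat.find_spec hex
    rw [h0, Finset.sum_range_zero] at this
    exact this.not_ge ht
  have h1 : ∑ i ∈ Finset.range m, u i ≤ t := not_lt.1 (Nat.find_min hex (by omega))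
  have h2 : t < ∑ i ∈ Finset.range (m + 1), u i := hm ▸ Nat.find_spec hex
  rw [← h, renewalCount_eq_of_le_of_lt hu h1 h2]
  exact ⟨h1, h2⟩

section Renewal

variable {Ω : Type*} [MeasurableSpace Ω] {P : Measure Ω} {U : ℕ → Ω → ℝ}
  {ν lam : ℝ}

/-- The distribution function of the `n`-th arrival time `U 0 + ⋯ + U (n - 1)`. -/
def arrivalCdf (P : Measure Ω) (U : ℕ → Ω → ℝ) (n : ℕ) (t : ℝ) : ℝ :=
  P.real {ω | ∑ i ∈ Finset.range n, U i ω ≤ t}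

lemma arrivalCdf_nonneg (n : ℕ) (t : ℝ) : 0 ≤ arrivalCdf P U n t := measureReal_nonneg

lemma arrivalCdf_eq_map (hU : ∀ i, Measurable (U i)) (n : ℕ) (t : ℝ) :
    arrivalCdf P U n t = (P.map (∑ i ∈ Finset.range n, U i)).real (Iic t) := by
  rw [map_measureReal_apply (by fun_prop) measurableSet_Iic, arrivalCdf]
  congr 1
  ext ω
  simp

lemma map_sum_Iio_zero (hU : ∀ i, Measurable (U i)) (hpos : ∀ᵐ ω ∂P, ∀ i, 0 < U i ω) (n : ℕ) :
    (P.map (∑ i ∈ Finset.range n, U i)) (Iio 0) = 0 := by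
  rw [Measure.map_apply (by fun_prop) measurableSet_Iio,
    measure_eq_zero_iff_ae_notMem]
  filter_upwards [hpos] with ω hω
  simpa using Finset.sum_nonneg fun i (_ : i ∈ Finset.range n) => (hω i).le

variable [IsProbabilityMeasure P]

lemma arrivalCdf_le_one (n : ℕ) (t : ℝ) : arrivalCdf P U n t ≤ 1 := measureReal_le_one

lemma arrivalCdf_zero {t : ℝ} (ht : 0 ≤ t) : arrivalCdf P U 0 t = 1 := by
  simp [arrivalCdf, ht]

lemma measurable_arrivalCdf (n : ℕ) : Measurable (arrivalCdf P U n) :=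
  Monotone.measurable fun _ _ hab => measureReal_mono fun _ (hω : _ ≤ _) => le_trans hω hab

lemma abs_arrivalCdf_sub_le_one (m n : ℕ) (t : ℝ) :
    |arrivalCdf P U m t - arrivalCdf P U n t| ≤ 1 :=
  abs_sub_le_of_nonneg_of_le (arrivalCdf_nonneg m t) (arrivalCdf_le_one m t)
    (arrivalCdf_nonneg n t) (arrivalCdf_le_one n t)

lemma arrivalCdf_succ_le (hpos : ∀ᵐ ω ∂P, ∀ i, 0 < U i ω) (n : ℕ) (t : ℝ) :
    arrivalCdf P U (n + 1) t ≤ arrivalCdf P U n t := by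
  refine ENNReal.toReal_mono (measure_ne_top _ _) (measure_mono_ae ?_)
  filter_upwards [hpos] with ω hω (h : _ ≤ t)
  rw [Finset.sum_range_succ] at h
  exact (le_add_of_nonneg_right (hω n).le).trans h

lemma ae_forall_pos {f : ℝ → ℝ} (hdens : ∀ i, HasDensityOnPos P (U i) f) :
    ∀ᵐ ω ∂P, ∀ i, 0 < U i ω :=
  ae_all_iff.2 fun i => (hdens i).ae_pos

/-- The recursion for the distribution functions of the arrival times. -/
lemma arrivalCdf_succ (hν : 0 < ν) (hlam : 0 < lam) (hU : ∀ i, Measurable (U i))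
    (hind : iIndepFun U P)
    (hdens : ∀ i, HasDensityOnPos P (U i) (interarrivalDensity ν lam)) (n : ℕ) {t : ℝ}
    (ht : 0 ≤ t) :
    arrivalCdf P U (n + 1) t =
      lam * rlIntegral ν (fun s => arrivalCdf P U n s - arrivalCdf P U (n + 1) s) t := by
  have hpos := ae_forall_pos hdens
  have hm : ∀ n, Measurable (∑ i ∈ Finset.range n, U i) := fun n => by fun_prop
  have : IsProbabilityMeasure (P.map (∑ i ∈ Finset.range n, U i)) :=
    Measure.isProbabilityMeasure_map (hm n).aemeasurable
  have hconv : P.map (∑ i ∈ Finset.range (n + 1), U i) =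
      P.map (∑ i ∈ Finset.range n, U i) ∗ P.map (U n) := by
    rw [Finset.sum_range_succ]
    exact (hind.indepFun_finsetSum_of_notMem hU
      (Finset.notMem_range_self (n := n))).map_add_eq_map_conv_map (hm n) (hU n)
  have h0 := map_sum_Iio_zero hU hpos (n + 1)
  simp only [arrivalCdf_eq_map hU]
  rw [hconv] at h0 ⊢
  exact real_conv_Iic_eq_rlIntegral hν hlam (hU n) (hdens n) _ (map_sum_Iio_zero hU hpos n) h0 ht

/-- The recursion forces the arrival times to tend to infinity: the decreasing sequence
`arrivalCdf P U n t` has increments tending to `0`, and `arrivalCdf P U (n + 1) t` is an integral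
of such increments. -/
lemma tendsto_arrivalCdf (hν : 0 < ν) (hlam : 0 < lam) (hU : ∀ i, Measurable (U i))
    (hind : iIndepFun U P)
    (hdens : ∀ i, HasDensityOnPos P (U i) (interarrivalDensity ν lam)) {t : ℝ} (ht : 0 ≤ t) :
    Filter.Tendsto (fun n => arrivalCdf P U n t) Filter.atTop (nhds 0) := by
  have hdiff : ∀ s, Filter.Tendsto (fun n => arrivalCdf P U n s - arrivalCdf P U (n + 1) s)
      Filter.atTop (nhds 0) := fun s => by
    have h := tendsto_atTop_ciInf (f := fun n => arrivalCdf P U n s)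
      (antitone_nat_of_succ_le fun n => arrivalCdf_succ_le (ae_forall_pos hdens) n s)
      ⟨0, by rintro _ ⟨n, rfl⟩; exact arrivalCdf_nonneg n s⟩
    simpa using h.sub (h.comp (Filter.tendsto_add_atTop_nat 1))
  have hlim : Filter.Tendsto
      (fun n => rlIntegral ν (fun s => arrivalCdf P U n s - arrivalCdf P U (n + 1) s) t)
      Filter.atTop (nhds (∫ s in (0 : ℝ)..t, (0 : ℝ))) := by
    refine intervalIntegral.tendsto_integral_filter_of_dominated_convergence
      (fun s => rlKernel ν (t - s)) (Filter.Eventually.of_forall fun n => ?_)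
      (Filter.Eventually.of_forall fun n => Filter.Eventually.of_forall fun s hs => ?_)
      (intervalIntegrable_rlKernel_sub hν t) (Filter.Eventually.of_forall fun s _ => ?_)
    · exact (((measurable_rlKernel ν).comp (measurable_const.sub measurable_id)).mul
        ((measurable_arrivalCdf n).sub (measurable_arrivalCdf (n + 1)))).aestronglyMeasurable
    · rw [uIoc_of_le ht] at hs
      have hk := rlKernel_nonneg hν (sub_nonneg.2 hs.2)
      rw [norm_mul, Real.norm_of_nonneg hk]
      refine mul_le_of_le_one_right hk ?_
      rw [Real.norm_eq_abs]
      exact abs_arrivalCdf_sub_le_one n (n + 1) s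
    · simpa using (hdiff s).const_mul (rlKernel ν (t - s))
  rw [← Filter.tendsto_add_atTop_iff_nat 1]
  simpa [arrivalCdf_succ hν hlam hU hind hdens _ ht] using hlim.const_mul lam

/-- Almost surely only finitely many renewals occur before `t`, so that `renewalCount` does not take
its default value for infinite sets. -/
lemma ae_exists_lt_arrival (hν : 0 < ν) (hlam : 0 < lam) (hU : ∀ i, Measurable (U i))
    (hind : iIndepFun U P)
    (hdens : ∀ i, HasDensityOnPos P (U i) (interarrivalDensity ν lam)) {t : ℝ} (ht : 0 ≤ t) :
    ∀ᵐ ω ∂P, ∃ n, t < ∑ i ∈ Finset.range n, U i ω := by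
  rw [ae_iff, ← measureReal_eq_zero_iff]
  refine le_antisymm (ge_of_tendsto' (tendsto_arrivalCdf hν hlam hU hind hdens ht) fun n => ?_)
    measureReal_nonneg
  refine measureReal_mono fun ω hω => ?_
  simp only [mem_ofPred_eq, not_exists, not_lt] at hω ⊢
  exact hω n

/-- The law of the renewal count, in terms of the distribution functions of the arrival times. -/
lemma measureReal_renewalCount_eq (hν : 0 < ν) (hlam : 0 < lam) (hU : ∀ i, Measurable (U i))
    (hind : iIndepFun U P)
    (hdens : ∀ i, HasDensityOnPos P (U i) (interarrivalDensity ν lam)) {t : ℝ} (ht : 0 ≤ t)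
    (n : ℕ) :
    P.real {ω | renewalCount (fun i => U i ω) t = n} =
      arrivalCdf P U n t - arrivalCdf P U (n + 1) t := by
  have hpos := ae_forall_pos hdens
  have hmeas : MeasurableSet {ω | ∑ i ∈ Finset.range (n + 1), U i ω ≤ t} :=
    measurableSet_le (Finset.measurable_fun_sum _ fun i _ => hU i) measurable_const
  have h1 : P.real {ω | renewalCount (fun i => U i ω) t = n} =
      P.real ({ω | ∑ i ∈ Finset.range n, U i ω ≤ t} \
        {ω | ∑ i ∈ Finset.range (n + 1), U i ω ≤ t}) := by
    refine measureReal_congr (Filter.eventuallyEq_set.2 ?_)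
    filter_upwards [hpos, ae_exists_lt_arrival hν hlam hU hind hdens ht] with ω hω hex
    simp only [mem_sdiff, mem_ofPred_eq, not_le]
    exact renewalCount_eq_iff hω ht hex
  have h2 : P.real ({ω | ∑ i ∈ Finset.range n, U i ω ≤ t} ∩
      {ω | ∑ i ∈ Finset.range (n + 1), U i ω ≤ t}) = arrivalCdf P U (n + 1) t := by
    refine measureReal_congr (Filter.eventuallyEq_set.2 ?_)
    filter_upwards [hpos] with ω hω
    simp only [mem_inter_iff, mem_ofPred_eq, and_iff_right_iff_imp]
    intro h
    rw [Finset.sum_range_succ] at h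
    exact (le_add_of_nonneg_right (hω n).le).trans h
  rw [h1, ← h2, eq_sub_iff_add_eq, measureReal_sdiff_add_inter hmeas, arrivalCdf]

end Renewal

/-! ### Compound sums -/

section Compound

variable {Ω : Type*} [MeasurableSpace Ω] {P : Measure Ω} [IsProbabilityMeasure P] {X : ℕ → Ω → ℕ}
  {k : ℕ} {lam : ℕ → ℝ}

/-- The law of the sum `X 0 + ⋯ + X (n - 1)`. -/
def sumProb (P : Measure Ω) (X : ℕ → Ω → ℕ) (n j : ℕ) : ℝ :=
  P.real {ω | ∑ i ∈ Finset.range n, X i ω = j}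

lemma sumProb_zero (j : ℕ) : sumProb P X 0 j = if j = 0 then 1 else 0 := by
  by_cases hj : j = 0
  · simp [sumProb, hj]
  · simp [sumProb, hj, Ne.symm hj]

lemma totalRate_pos (hk : 1 ≤ k) (hlam : ∀ j ∈ Finset.Icc 1 k, 0 < lam j) : 0 < totalRate k lam :=
  Finset.sum_pos hlam ⟨1, Finset.mem_Icc.2 ⟨le_rfl, hk⟩⟩

lemma ae_mem_Icc_of_law (hΛ : 0 < totalRate k lam) {Y : Ω → ℕ} (hY : Measurable Y)
    (hlaw : ∀ j ∈ Finset.Icc 1 k, P.real {ω | Y ω = j} = lam j / totalRate k lam) :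
    ∀ᵐ ω ∂P, Y ω ∈ Finset.Icc 1 k := by
  have hm : MeasurableSet {ω | Y ω ∈ Finset.Icc 1 k} := hY (Finset.measurableSet _)
  have h1 : P.real {ω | Y ω ∈ Finset.Icc 1 k} = 1 := by
    have hU : {ω | Y ω ∈ Finset.Icc 1 k} = ⋃ j ∈ Finset.Icc 1 k, {ω | Y ω = j} := by
      ext ω
      simp
    rw [hU, measureReal_biUnion_finset, Finset.sum_congr rfl hlaw, ← Finset.sum_div]
    · exact div_self hΛ.ne'
    · exact fun i _ j _ hij => disjoint_left.2 fun ω h h' => hij (h.symm.trans h')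
    · exact fun j _ => hY (measurableSet_singleton j)
  rw [measureReal_def, ENNReal.toReal_eq_one_iff] at h1
  exact (prob_compl_eq_zero_iff hm).2 h1

/-- The recursion obtained by conditioning on the last summand. -/
lemma sumProb_succ (hΛ : 0 < totalRate k lam) (hX : ∀ n, Measurable (X n)) (hind : iIndepFun X P)
    (hlaw : ∀ n, ∀ j ∈ Finset.Icc 1 k, P.real {ω | X n ω = j} = lam j / totalRate k lam)
    (n j : ℕ) :
    totalRate k lam * sumProb P X (n + 1) j =
      ∑ r ∈ Finset.Icc 1 (min j k), lam r * sumProb P X n (j - r) := by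
  have hm : Measurable (∑ i ∈ Finset.range n, X i) := by fun_prop
  have hindep := hind.indepFun_finsetSum_of_notMem hX (Finset.notMem_range_self (n := n))
  have h1 : sumProb P X (n + 1) j = P.real (⋃ r ∈ Finset.Icc 1 (min j k),
      ((∑ i ∈ Finset.range n, X i) ⁻¹' {j - r} ∩ X n ⁻¹' {r})) := by
    refine measureReal_congr (Filter.eventuallyEq_set.2 ?_)
    filter_upwards [ae_mem_Icc_of_law hΛ (hX n) (hlaw n)] with ω hω
    rw [Finset.mem_Icc] at hω
    simp only [mem_iUnion, mem_inter_iff, mem_preimage, mem_singleton_iff,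
      Finset.sum_apply, Finset.mem_Icc, le_min_iff, Finset.sum_range_succ]
    refine ⟨fun h => ⟨X n ω, by omega, by omega, rfl⟩, ?_⟩
    rintro ⟨r, hr, h, h'⟩
    omega
  rw [h1, measureReal_biUnion_finset, Finset.mul_sum]
  · refine Finset.sum_congr rfl fun r hr => ?_
    rw [Finset.mem_Icc, le_min_iff] at hr
    rw [measureReal_def, hindep.measure_inter_preimage_eq_mul _ _ (measurableSet_singleton _)
      (measurableSet_singleton _), ENNReal.toReal_mul, ← measureReal_def, ← measureReal_def]
    have e1 : P.real (X n ⁻¹' {r}) = lam r / totalRate k lam :=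
      hlaw n r (Finset.mem_Icc.2 ⟨hr.1, hr.2.2⟩)
    have e2 : P.real ((∑ i ∈ Finset.range n, X i) ⁻¹' {j - r}) = sumProb P X n (j - r) := by
      rw [sumProb]
      congr 1
      ext ω
      simp
    rw [e1, e2]
    field_simp
  · exact fun r _ r' _ hrr' => disjoint_left.2 fun ω h h' => hrr' (h.2.symm.trans h'.2)
  · exact fun r _ => (hm (measurableSet_singleton _)).inter (hX n (measurableSet_singleton _))

lemma sumProb_eq_zero_of_lt (hΛ : 0 < totalRate k lam) (hX : ∀ n, Measurable (X n))
    (hlaw : ∀ n, ∀ j ∈ Finset.Icc 1 k, P.real {ω | X n ω = j} = lam j / totalRate k lam)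
    {n j : ℕ} (hj : j < n) : sumProb P X n j = 0 := by
  rw [sumProb, measureReal_eq_zero_iff, measure_eq_zero_iff_ae_notMem]
  filter_upwards [ae_all_iff.2 fun n => ae_mem_Icc_of_law hΛ (hX n) (hlaw n)] with ω hω
  have : n ≤ ∑ i ∈ Finset.range n, X i ω := by
    simpa using Finset.card_nsmul_le_sum (Finset.range n) (fun i => X i ω) 1
      fun i _ => (Finset.mem_Icc.1 (hω i)).1
  exact fun h : _ = j => by omega

/-- The law of a random sum with an independent number of summands; as the summands are at least
`1`, a sum equal to `j` has at most `j` of them. -/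
lemma measureReal_randomSum_eq (hΛ : 0 < totalRate k lam) (hX : ∀ n, Measurable (X n))
    (hlaw : ∀ n, ∀ j ∈ Finset.Icc 1 k, P.real {ω | X n ω = j} = lam j / totalRate k lam)
    {K : Ω → ℕ} (hK : Measurable K) (hKX : IndepFun K (fun ω n => X n ω) P) (j : ℕ) :
    P.real {ω | ∑ i ∈ Finset.range (K ω), X i ω = j} =
      ∑ n ∈ Finset.range (j + 1), P.real {ω | K ω = n} * sumProb P X n j := by
  have hS : ∀ n, Measurable fun x : ℕ → ℕ => ∑ i ∈ Finset.range n, x i := fun n =>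
    Finset.measurable_fun_sum _ fun i _ => measurable_pi_apply i
  have hXm : Measurable fun ω n => X n ω := measurable_pi_lambda _ hX
  let B : ℕ → Set (ℕ → ℕ) := fun n => {x | ∑ i ∈ Finset.range n, x i = j}
  have hB : ∀ n, MeasurableSet (B n) := fun n => hS n (measurableSet_singleton j)
  have h1 : P.real {ω | ∑ i ∈ Finset.range (K ω), X i ω = j} =
      P.real (⋃ n ∈ Finset.range (j + 1), (K ⁻¹' {n} ∩ (fun ω n => X n ω) ⁻¹' B n)) := by
    refine measureReal_congr (Filter.eventuallyEq_set.2 ?_)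
    filter_upwards [ae_all_iff.2 fun n => ae_mem_Icc_of_law hΛ (hX n) (hlaw n)] with ω hω
    have : K ω ≤ ∑ i ∈ Finset.range (K ω), X i ω := by
      simpa using Finset.card_nsmul_le_sum (Finset.range (K ω)) (fun i => X i ω) 1
        fun i _ => (Finset.mem_Icc.1 (hω i)).1
    simp only [mem_ofPred_eq, mem_iUnion, mem_inter_iff, mem_preimage, mem_singleton_iff,
      Finset.mem_range, B]
    refine ⟨fun h => ⟨K ω, by omega, rfl, h⟩, ?_⟩
    rintro ⟨n, -, rfl, h⟩
    exact h
  rw [h1, measureReal_biUnion_finset]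
  · refine Finset.sum_congr rfl fun n _ => ?_
    rw [measureReal_def, hKX.measure_inter_preimage_eq_mul _ _ (measurableSet_singleton _) (hB n),
      ENNReal.toReal_mul]
    rfl
  · exact fun r _ r' _ hrr' => disjoint_left.2 fun ω h h' => hrr' (h.1.symm.trans h'.1)
  · exact fun r _ => (hK (measurableSet_singleton _)).inter (hXm (hB r))

/-- Summation by parts. -/
lemma sum_range_sub_mul_eq (F c : ℕ → ℝ) (m : ℕ) :
    ∑ n ∈ Finset.range m, (F n - F (n + 1)) * c n =
      c 0 * F 0 + ∑ n ∈ Finset.range m, (c (n + 1) - c n) * F (n + 1) - c m * F m := by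
  induction m with
  | zero => simp
  | succ m ih =>
    rw [Finset.sum_range_succ, ih, Finset.sum_range_succ]
    ring

/-- The probabilities of the random sum, written through the distribution functions of the arrival
times. -/
def compoundProb (P : Measure Ω) (U : ℕ → Ω → ℝ) (X : ℕ → Ω → ℕ) (j : ℕ) (t : ℝ) : ℝ :=
  ∑ n ∈ Finset.range (j + 1),
    (arrivalCdf P U n t - arrivalCdf P U (n + 1) t) * sumProb P X n j

lemma measurable_compoundProb (U : ℕ → Ω → ℝ) (j : ℕ) : Measurable (compoundProb P U X j) :=
  Finset.measurable_fun_sum _ fun n _ =>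
    ((measurable_arrivalCdf n).sub (measurable_arrivalCdf (n + 1))).mul_const _

lemma abs_compoundProb_le (U : ℕ → Ω → ℝ) (j : ℕ) (t : ℝ) :
    |compoundProb P U X j t| ≤ (j + 1 : ℕ) := by
  refine (Finset.abs_sum_le_sum_abs _ _).trans ?_
  refine (Finset.sum_le_card_nsmul _ _ 1 fun n _ => ?_).trans (by simp)
  rw [abs_mul]
  refine mul_le_one₀ (abs_arrivalCdf_sub_le_one n (n + 1) t) (abs_nonneg _) ?_
  rw [sumProb, abs_of_nonneg measureReal_nonneg]
  exact measureReal_le_one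

/-- The probabilities of the random sum solve the Volterra form of the fractional system. -/
lemma compoundProb_eq {ν : ℝ} (hν : 0 < ν) (hΛ : 0 < totalRate k lam) {U : ℕ → Ω → ℝ}
    (hU : ∀ i, Measurable (U i)) (hUind : iIndepFun U P)
    (hdens : ∀ i, HasDensityOnPos P (U i) (interarrivalDensity ν (totalRate k lam)))
    (hX : ∀ n, Measurable (X n)) (hind : iIndepFun X P)
    (hlaw : ∀ n, ∀ j ∈ Finset.Icc 1 k, P.real {ω | X n ω = j} = lam j / totalRate k lam)
    (j : ℕ) {t : ℝ} (ht : 0 ≤ t) :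
    compoundProb P U X j t = (if j = 0 then 1 else 0) +
      rlIntegral ν (fun s => ∑ r ∈ Finset.Icc 1 (min j k), lam r * compoundProb P U X (j - r) s -
        totalRate k lam * compoundProb P U X j s) t := by
  set Λ := totalRate k lam
  set F := arrivalCdf P U
  set c := sumProb P X
  have hc : ∀ {n j}, j < n → c n j = 0 := fun h => sumProb_eq_zero_of_lt hΛ hX hlaw h
  -- all components may be summed over the same range of `n`, the additional terms being zero
  have hext : ∀ r, 1 ≤ r → r ≤ j → ∀ s, compoundProb P U X (j - r) s =
      ∑ n ∈ Finset.range (j + 1), (F n s - F (n + 1) s) * c n (j - r) := fun r h1 h2 s => by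
    refine Finset.sum_subset (Finset.range_mono (by omega)) fun n _ hn => ?_
    rw [Finset.mem_range, not_lt] at hn
    rw [show sumProb P X n (j - r) = 0 from hc (by omega), mul_zero]
  have hpt : ∀ s, ∑ r ∈ Finset.Icc 1 (min j k), lam r * compoundProb P U X (j - r) s -
      Λ * compoundProb P U X j s =
      ∑ n ∈ Finset.range (j + 1), Λ * (c (n + 1) j - c n j) * (F n s - F (n + 1) s) := fun s => by
    have h1 : ∑ r ∈ Finset.Icc 1 (min j k), lam r * compoundProb P U X (j - r) s =
        ∑ n ∈ Finset.range (j + 1), Λ * c (n + 1) j * (F n s - F (n + 1) s) := by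
      have : ∀ n, Λ * c (n + 1) j = ∑ r ∈ Finset.Icc 1 (min j k), lam r * c n (j - r) :=
        fun n => sumProb_succ hΛ hX hind hlaw n j
      simp only [this, Finset.sum_mul]
      rw [Finset.sum_comm]
      refine Finset.sum_congr rfl fun r hr => ?_
      rw [Finset.mem_Icc, le_min_iff] at hr
      rw [hext r hr.1 hr.2.1, Finset.mul_sum]
      exact Finset.sum_congr rfl fun n _ => by ring
    rw [h1, compoundProb, Finset.mul_sum, ← Finset.sum_sub_distrib]
    exact Finset.sum_congr rfl fun n _ => by ring
  have hint : ∀ n, IntervalIntegrable (fun s => rlKernel ν (t - s) * (F n s - F (n + 1) s))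
      volume 0 t := fun n =>
    intervalIntegrable_rlKernel_mul hν (C := 1) ht
      ((measurable_arrivalCdf n).sub (measurable_arrivalCdf (n + 1))).aestronglyMeasurable
      fun s _ => abs_arrivalCdf_sub_le_one n (n + 1) s
  have hI : rlIntegral ν (fun s => ∑ r ∈ Finset.Icc 1 (min j k),
      lam r * compoundProb P U X (j - r) s - Λ * compoundProb P U X j s) t =
      ∑ n ∈ Finset.range (j + 1), (c (n + 1) j - c n j) * F (n + 1) t := by
    simp only [hpt, rlIntegral, Finset.mul_sum]
    have e : ∀ n s, rlKernel ν (t - s) * (Λ * (c (n + 1) j - c n j) * (F n s - F (n + 1) s)) =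
        Λ * (c (n + 1) j - c n j) * (rlKernel ν (t - s) * (F n s - F (n + 1) s)) :=
      fun n s => by ring
    simp only [e]
    rw [intervalIntegral.integral_finsetSum fun n _ => (hint n).const_mul _]
    refine Finset.sum_congr rfl fun n _ => ?_
    rw [intervalIntegral.integral_const_mul,
      show F (n + 1) t = Λ * rlIntegral ν (fun s => F n s - F (n + 1) s) t from
        arrivalCdf_succ hν hΛ hU hUind hdens n ht, rlIntegral]
    ring
  rw [hI, compoundProb, sum_range_sub_mul_eq (fun n => F n t) (fun n => c n j) (j + 1),
    show c 0 j = _ from sumProb_zero j, show F 0 t = 1 from arrivalCdf_zero ht,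
    hc (Nat.lt_succ_self j)]
  ring

end Compound

/-- The probabilities of the counting process solve the Volterra form of the fractional system. -/
lemma SolvesFractionalSystem.eq_add_rlIntegral {ν : ℝ} {k : ℕ} {lam : ℕ → ℝ} {p : ℕ → ℝ → ℝ}
    (h : SolvesFractionalSystem ν k lam p) (hν : 0 < ν) (j : ℕ) {t : ℝ} (ht : 0 ≤ t) :
    p j t = (if j = 0 then 1 else 0) +
      rlIntegral ν (fun s => ∑ r ∈ Finset.Icc 1 (min j k), lam r * p (j - r) s -
        totalRate k lam * p j s) t := by
  rw [← h.initial j]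
  refine eq_add_rlIntegral_of_hasCaputoDerivAt hν (h.continuousOn j) ?_ (h.equation j) ht
  exact (continuousOn_finsetSum _ fun r _ => continuousOn_const.mul (h.continuousOn (j - r))).sub
    (continuousOn_const.mul (h.continuousOn j))

end

end FracCounting

theorem mainTheorem3
    {Ω₁ Ω₂ : Type*} [MeasurableSpace Ω₁] [MeasurableSpace Ω₂]
    (P₁ : Measure Ω₁) [IsProbabilityMeasure P₁]
    (P₂ : Measure Ω₂) [IsProbabilityMeasure P₂]
    (ν : ℝ) (hν₀ : 0 < ν) (hν₁ : ν ≤ 1)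
    (k : ℕ) (hk : 1 ≤ k)
    (lam : ℕ → ℝ) (hlam : ∀ j ∈ Finset.Icc 1 k, 0 < lam j)
    (M : ℝ≥0 → Ω₁ → ℕ)
    (hM : FracCounting.IsFractionalCountingProcess P₁ ν k lam M)
    (N : ℝ≥0 → Ω₂ → ℕ)
    (hN : FracCounting.IsFractionalPoissonProcess P₂ ν (FracCounting.totalRate k lam) N)
    (X : ℕ → Ω₂ → ℕ) (hX : ∀ n, Measurable (X n))
    (hXindep : iIndepFun X P₂)
    (hXlaw : ∀ n, ∀ j ∈ Finset.Icc 1 k,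
      P₂.real {ω | X n ω = j} = lam j / FracCounting.totalRate k lam)
    (hNX : ∀ t, IndepFun (N t) (fun ω n => X n ω) P₂) :
    ∀ t : ℝ≥0,
      IdentDistrib (M t) (fun ω => ∑ i ∈ Finset.range (N t ω), X i ω) P₁ P₂ := by
  intro t
  obtain ⟨hMm, hMp⟩ := hM
  obtain ⟨hNm, U, hU, hUind, hdens, hNU⟩ := hN
  have hΛ := FracCounting.totalRate_pos hk hlam
  have hSm : Measurable fun ω => ∑ i ∈ Finset.range (N t ω), X i ω := by
    have : Measurable fun z : ℕ × Ω₂ => ∑ i ∈ Finset.range z.1, X i z.2 :=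
      measurable_from_prod_countable_right fun n =>
        Finset.measurable_fun_sum (Finset.range n) fun i _ => hX i
    exact this.comp ((hNm t).prodMk measurable_id)
  have hN_law : ∀ n, P₂.real {ω | N t ω = n} =
      FracCounting.arrivalCdf P₂ U n t - FracCounting.arrivalCdf P₂ U (n + 1) t := fun n => by
    rw [← FracCounting.measureReal_renewalCount_eq hν₀ hΛ hU hUind hdens t.coe_nonneg n]
    refine measureReal_congr (Filter.eventuallyEq_set.2 ?_)
    filter_upwards [hNU] with ω hω
    simp only [hω t]
  refine ⟨(hMm t).aemeasurable, hSm.aemeasurable, Measure.ext_of_singleton fun j => ?_⟩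
  rw [Measure.map_apply (hMm t) (measurableSet_singleton j),
    Measure.map_apply hSm (measurableSet_singleton j), ← measureReal_eq_measureReal_iff]
  have h := FracCounting.volterra_system_unique hν₀ hΛ k lam
    (fun j => ((hMp.continuousOn j).mono Ioi_subset_Ici_self).aestronglyMeasurable
      measurableSet_Ioi)
    (fun j => (FracCounting.measurable_compoundProb (P := P₂) (X := X) U j).aestronglyMeasurable)
    (fun j => ⟨1, fun s _ => by
      rw [abs_of_nonneg measureReal_nonneg]
      exact measureReal_le_one⟩)
    (fun j => ⟨_, fun s _ => FracCounting.abs_compoundProb_le U j s⟩)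
    (fun j s hs => hMp.eq_add_rlIntegral hν₀ j hs)
    (fun j s hs => FracCounting.compoundProb_eq hν₀ hΛ hU hUind hdens hX hXindep hXlaw j hs)
    j t t.coe_nonneg
  have h' := FracCounting.measureReal_randomSum_eq hΛ hX hXlaw (hNm t) (hNX t) j
  simp only [hN_law] at h'
  rw [Real.toNNReal_coe] at h
  exact h.trans h'.symm
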